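/- Let $n$ and $m\ge 1$ be integers, and let $\rho$ be the density matrix of an $n$-qubit system, i.e. a positive semidefinite (Hermitian) complex $2^n\times 2^n$ matrix with $\mathrm{Tr}(\rho)=1$. Let $\sigma_x,\sigma_y,\sigma_z$ be the Pauli matrices and $\sigma_I=I$. For $\mathbf b\in\{I,x,y,z\}^n$ put $\sigma_{\mathbf b}=\sigma_{b_1}\otimes\cdots\otimes\sigma_{b_n}$, let $d(\mathbf b)$ be the number of $j$ with $b_j=I$, and let $\vec\rho=(\rho_{\mathbf b})_{\mathbf b}$ be the real Pauli coefficients of $\rho$, i.e. $\rho=\sum_{\mathbf b}\rho_{\mathbf b}\sigma_{\mathbf b}$. For $\mathbf a\in\{x,y,z\}^n$ and $\mathbf r\in\{-1,1\}^n$ let $P_{\mathbf r}^{\mathbf a}=P_{r_1}^{a_1}\otimes\cdots\otimes P_{r_n}^{a_n}$, where $P_s^t$ is the projector on the eigenspace of $\sigma_t$ for the eigenvalue $s$. Let $R^{\mathbf a,i}$ ($\mathbf a\in\{x,y,z\}^n$, $1\le i\le m$) be independent random variables in $\{-1,1\}^n$ with $\mathbb P(R^{\mathbf a,i}=\mathbf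 r)=\mathrm{Tr}(\rho P_{\mathbf r}^{\mathbf a})$ for all $\mathbf r$. Let $\hat p_{(\mathbf r,\mathbf a)}=\frac1m\sum_{i=1}^m \mathbf 1(R^{\mathbf a,i}=\mathbf r)$, let $\mathbf P$ be the matrix with entries $\mathbf P_{(\mathbf r,\mathbf a),\mathbf b}=\prod_{j:\,b_j\ne I} r_j\,\mathbf 1(a_j=b_j)$, and define the linear (moment) estimators $\hat{\vec\rho}=(\hat\rho_{\mathbf b})_{\mathbf b}=(\mathbf P^T\mathbf P)^{-1}\mathbf P^T\hat{\mathbf p}$ and $\hat\rho=\sum_{\mathbf b}\hat\rho_{\mathbf b}\,\sigma_{\mathbf b}$. Then: 1. $\hat{\vec\rho}$ is unbiased: $\mathbb E[\hat\rho_{\mathbf b}]=\rho_{\mathbf b}$ for every $\mathbf b$; 2. for every $\mathbf b$, $\mathrm{Var}(\hat\rho_{\mathbf b})\le \dfrac{1}{3^{d(\mathbf b)}\,4^n\,m}$; 3. for every $\varepsilon>0$, with $\|\cdot\|$ the operator norm, $$\mathbb P\left(\|\hat\rho-\rho\|\ \ge\ 4\sqrt{2\left(\tfrac43\right)^n\frac{n\log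 2-\log\varepsilon}{m}}\right)\le\varepsilon$$ (for $\varepsilon>2^n$, where the quantity under the root is negative, the root is read as $0$). -/

import Mathlib

open MeasureTheory ProbabilityTheory
open scoped Matrix ComplexOrder

namespace QubitTomography

/-- The three directions `x, y, z` of a Pauli measurement. -/
inductive Axis
  | x
  | y
  | z
  deriving DecidableEq

instance : Fintype Axis where
  elems := {Axis.x, Axis.y, Axis.z}
  complete t := by cases t <;> simp

/-- Measurement settings `a ∈ {x, y, z}ⁿ`. -/
abbrev Setting (n : ℕ) := Fin n → Axis

/-- Outcomes `r ∈ {-1, 1}ⁿ`; `ℤˣ` is the set `{1, -1}`. -/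
abbrev Outcome (n : ℕ) := Fin n → ℤˣ

instance : MeasurableSingletonClass ℤˣ where
  measurableSet_singleton s :=
    ⟨{(s : ℤ)}, measurableSet_singleton _, by ext u; simp [Units.ext_iff]⟩

/-- Labels `b ∈ {I, x, y, z}ⁿ` of the Pauli basis; `none` stands for `I`. -/
abbrev Label (n : ℕ) := Fin n → Option Axis

/-- The computational basis `{0, 1}ⁿ`, which indexes the rows and columns of `2ⁿ × 2ⁿ` matrices. -/
abbrev Idx (n : ℕ) := Fin n → Fin 2

/-- `2ⁿ × 2ⁿ` complex matrices. -/
abbrev QMatrix (n : ℕ) := Matrix (Idx n) (Idx n) ℂ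

/-- The Pauli matrices `σ_x, σ_y, σ_z`. -/
def pauli : Axis → Matrix (Fin 2) (Fin 2) ℂ
  | .x => !![0, 1; 1, 0]
  | .y => !![0, -Complex.I; Complex.I, 0]
  | .z => !![1, 0; 0, -1]

/-- The Pauli matrices together with `σ_I = I`. -/
def pauliI : Option Axis → Matrix (Fin 2) (Fin 2) ℂ
  | none => 1
  | some t => pauli t

/-- The projector `P_s^t` on the eigenvectors of `σ_t` for the eigenvalue `s`
(see `eigenProj_spec`). -/
noncomputable def eigenProj (t : Axis) (s : ℤˣ) : Matrix (Fin 2) (Fin 2) ℂ :=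
  (1 / 2 : ℂ) • (1 + ((s : ℤ) : ℂ) • pauli t)

/-- `eigenProj t s` is the orthogonal projection onto the eigenspace of `σ_t` for the
eigenvalue `s`. -/
theorem eigenProj_spec (t : Axis) (s : ℤˣ) :
    (eigenProj t s).IsHermitian ∧ eigenProj t s * eigenProj t s = eigenProj t s ∧
      ∀ v : Fin 2 → ℂ, eigenProj t s *ᵥ v = v ↔ pauli t *ᵥ v = ((s : ℤ) : ℂ) • v := by
  have hsq : pauli t * pauli t = 1 := by
    cases t <;> ext i j <;> fin_cases i <;> fin_cases j <;> simp [pauli]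
  have hH : (pauli t)ᴴ = pauli t := by
    cases t <;> ext i j <;> fin_cases i <;> fin_cases j <;> simp [pauli]
  have hs : ((s : ℤ) : ℂ) * ((s : ℤ) : ℂ) = 1 := by
    rcases Int.units_eq_one_or s with h | h <;> simp [h]
  have hstar : star ((s : ℤ) : ℂ) = ((s : ℤ) : ℂ) := by simp
  refine ⟨?_, ?_, fun v => ?_⟩
  · simp [Matrix.IsHermitian, eigenProj, Matrix.conjTranspose_smul, hH]
  · have h1 : (((s : ℤ) : ℂ) • pauli t) * (((s : ℤ) : ℂ) • pauli t) = 1 := by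
      rw [smul_mul_smul_comm, hsq, hs, one_smul]
    simp only [eigenProj, smul_mul_smul_comm, mul_add, add_mul, mul_one, one_mul, h1]
    module
  · have hP : eigenProj t s *ᵥ v = (1 / 2 : ℂ) • (v + ((s : ℤ) : ℂ) • pauli t *ᵥ v) := by
      rw [eigenProj, Matrix.smul_mulVec, Matrix.add_mulVec, Matrix.one_mulVec,
        Matrix.smul_mulVec]
    rw [hP]
    constructor
    · intro h
      have h2 : ((s : ℤ) : ℂ) • pauli t *ᵥ v = v := by
        calc ((s : ℤ) : ℂ) • pauli t *ᵥ v
            = (2 : ℂ) • ((1 / 2 : ℂ) • (v + ((s : ℤ) : ℂ) • pauli t *ᵥ v)) - v := by module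
          _ = v := by rw [h]; module
      calc pauli t *ᵥ v = (((s : ℤ) : ℂ) * ((s : ℤ) : ℂ)) • pauli t *ᵥ v := by
            rw [hs, one_smul]
        _ = ((s : ℤ) : ℂ) • v := by rw [mul_smul, h2]
    · intro h
      rw [h, smul_smul, hs]
      module

/-- The tensor product `A₁ ⊗ ⋯ ⊗ Aₙ` of `2 × 2` matrices. -/
def tensor {n : ℕ} (A : Fin n → Matrix (Fin 2) (Fin 2) ℂ) : QMatrix n :=
  Matrix.of fun i j => ∏ k, A k (i k) (j k)

/-- `σ_b = σ_{b₁} ⊗ ⋯ ⊗ σ_{bₙ}`. -/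
def pauliString {n : ℕ} (b : Label n) : QMatrix n :=
  tensor fun k => pauliI (b k)

/-- `P_r^a = P_{r₁}^{a₁} ⊗ ⋯ ⊗ P_{rₙ}^{aₙ}`. -/
noncomputable def outcomeProj {n : ℕ} (a : Setting n) (r : Outcome n) : QMatrix n :=
  tensor fun k => eigenProj (a k) (r k)

/-- Density matrices: positive semidefinite (hence Hermitian) with trace one. -/
def IsDensityMatrix {n : ℕ} (ρ : QMatrix n) : Prop :=
  ρ.PosSemidef ∧ ρ.trace = 1

/-- `d(b)`, the number of `j` with `b_j = I`. -/
def numI {n : ℕ} (b : Label n) : ℕ :=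
  (Finset.univ.filter fun j => b j = none).card

/-- The matrix `P` with entries `P_{(r,a),b} = ∏_{j : b_j ≠ I} r_j 1(a_j = b_j)`. -/
def designMatrix (n : ℕ) : Matrix (Outcome n × Setting n) (Label n) ℝ :=
  Matrix.of fun p b =>
    ∏ j ∈ Finset.univ.filter (fun j => b j ≠ none),
      ((p.1 j : ℤ) : ℝ) * (if b j = some (p.2 j) then 1 else 0)

/-- The empirical frequencies `p̂_{(r,a)} = (1/m) ∑ᵢ 1(R^{a,i} = r)` of the data `R`. -/
noncomputable def empiricalFreq {n m : ℕ} (R : Setting n → Fin m → Outcome n)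
    (p : Outcome n × Setting n) : ℝ :=
  (1 / (m : ℝ)) * ∑ i, if R p.2 i = p.1 then 1 else 0

/-- The vector `(PᵀP)⁻¹ Pᵀ p̂` of estimated Pauli coefficients. -/
noncomputable def coeffEstimator {n m : ℕ} (R : Setting n → Fin m → Outcome n) : Label n → ℝ :=
  ((designMatrix n)ᵀ * designMatrix n)⁻¹ *ᵥ ((designMatrix n)ᵀ *ᵥ empiricalFreq R)

/-- The matrix `∑_b c_b σ_b` with Pauli coefficients `c`. -/
noncomputable def ofCoeff {n : ℕ} (c : Label n → ℝ) : QMatrix n :=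
  ∑ b, ((c b : ℝ) : ℂ) • pauliString b

/-- The linear (moment, inversion) estimator `ρ̂ = ∑_b ρ̂_b σ_b`. -/
noncomputable def linearEstimator {n m : ℕ} (R : Setting n → Fin m → Outcome n) : QMatrix n :=
  ofCoeff (coeffEstimator R)

/-- The operator norm of a matrix with respect to the Euclidean norm. -/
noncomputable def opNorm {n : ℕ} (A : QMatrix n) : ℝ :=
  ‖Matrix.toEuclideanCLM (n := Idx n) (𝕜 := ℂ) A‖

/-- The Pauli coefficients `ρ_b` of a Hermitian matrix (see `ofCoeff_eq_iff`). -/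
noncomputable def pauliCoeff {n : ℕ} (ρ : QMatrix n) (b : Label n) : ℝ :=
  ((pauliString b * ρ).trace).re / 2 ^ n

theorem pauliString_isHermitian {n : ℕ} (b : Label n) : (pauliString b).IsHermitian := by
  have h : ∀ (o : Option Axis) (i j : Fin 2), star (pauliI o j i) = pauliI o i j := by
    intro o i j
    rcases o with _ | t
    · fin_cases i <;> fin_cases j <;> simp [pauliI]
    · cases t <;> fin_cases i <;> fin_cases j <;> simp [pauliI, pauli]
  ext i j
  simp only [Matrix.conjTranspose_apply, pauliString, tensor, Matrix.of_apply, star_prod, h]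

theorem sum_pauliString_mul {n : ℕ} (i j k l : Idx n) :
    ∑ b : Label n, pauliString b i j * pauliString b k l =
      if i = l ∧ j = k then 2 ^ n else 0 := by
  have h1 : ∀ i j k l : Fin 2, ∑ o : Option Axis, pauliI o i j * pauliI o k l =
      if i = l ∧ j = k then 2 else 0 := by
    have hA : (Finset.univ : Finset Axis) = {Axis.x, Axis.y, Axis.z} := rfl
    intro i j k l
    rw [Fintype.sum_option, hA, Finset.sum_insert (by simp), Finset.sum_insert (by simp),
      Finset.sum_singleton]
    fin_cases i <;> fin_cases j <;> fin_cases k <;> fin_cases l <;>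
      norm_num [pauliI, pauli, Matrix.one_apply]
  simp only [pauliString, tensor, Matrix.of_apply, ← Finset.prod_mul_distrib]
  rw [← Fintype.prod_sum (fun q o => pauliI o (i q) (j q) * pauliI o (k q) (l q))]
  simp only [h1]
  split_ifs with h
  · obtain ⟨rfl, rfl⟩ := h
    simp
  · obtain ⟨q, hq⟩ : ∃ q, ¬ (i q = l q ∧ j q = k q) := by
      by_contra hc
      push Not at hc
      exact h ⟨funext fun q => (hc q).1, funext fun q => (hc q).2⟩
    exact Finset.prod_eq_zero (Finset.mem_univ q) (if_neg hq)

theorem trace_pauliString_mul {n : ℕ} (b c : Label n) :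
    (pauliString b * pauliString c).trace = if b = c then 2 ^ n else 0 := by
  have h1 : ∀ o p : Option Axis, ∑ i, ∑ j, pauliI o i j * pauliI p j i =
      if o = p then 2 else 0 := by
    intro o p
    rcases o with _ | t <;> rcases p with _ | u
    · norm_num [pauliI, Matrix.one_apply]
    · cases u <;> simp [pauliI, pauli, Matrix.one_apply]
    · cases t <;> simp [pauliI, pauli, Matrix.one_apply]
    · cases t <;> cases u <;> simp [pauliI, pauli] <;> norm_num
  have h2 : (pauliString b * pauliString c).trace =
      ∏ q, ∑ i, ∑ j, pauliI (b q) i j * pauliI (c q) j i := by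
    rw [Fintype.prod_sum]
    simp only [Fintype.prod_sum, Matrix.trace, Matrix.diag, Matrix.mul_apply, pauliString,
      tensor, Matrix.of_apply, Finset.prod_mul_distrib]
  rw [h2]
  simp only [h1]
  split_ifs with h
  · subst h
    simp
  · obtain ⟨q, hq⟩ := Function.ne_iff.mp h
    exact Finset.prod_eq_zero (Finset.mem_univ q) (if_neg hq)

/-- A Hermitian matrix `ρ` is `∑_b c_b σ_b` for exactly one real vector `c`, namely
`pauliCoeff ρ`. -/
theorem ofCoeff_eq_iff {n : ℕ} {ρ : QMatrix n} (hρ : ρ.IsHermitian) (c : Label n → ℝ) :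
    ofCoeff c = ρ ↔ c = pauliCoeff ρ := by
  have h2 : (2 : ℂ) ^ n ≠ 0 := pow_ne_zero n two_ne_zero
  have hre : ∀ b : Label n, ((pauliCoeff ρ b : ℝ) : ℂ) = (pauliString b * ρ).trace / 2 ^ n := by
    intro b
    have hs : star (pauliString b * ρ).trace = (pauliString b * ρ).trace := by
      rw [← Matrix.trace_conjTranspose, Matrix.conjTranspose_mul, hρ.eq,
        (pauliString_isHermitian b).eq, Matrix.trace_mul_comm]
    have hr : (((pauliString b * ρ).trace.re : ℝ) : ℂ) = (pauliString b * ρ).trace :=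
      Complex.conj_eq_iff_re.mp hs
    simp [pauliCoeff, hr]
  constructor
  · intro h
    funext b
    have ht : (pauliString b * ρ).trace = 2 ^ n * (c b : ℂ) := by
      simp only [← h, ofCoeff, Finset.mul_sum, Matrix.trace_sum, mul_smul_comm,
        Matrix.trace_smul, trace_pauliString_mul, smul_eq_mul, mul_ite, mul_zero,
        Finset.sum_ite_eq, Finset.mem_univ, if_true]
      ring
    have := hre b
    rw [ht, mul_div_cancel_left₀ _ h2] at this
    exact_mod_cast this.symm
  · rintro rfl
    ext i j
    have h3 : ∀ b : Label n, ((pauliCoeff ρ b : ℝ) : ℂ) * pauliString b i j =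
        ∑ k, ∑ l, (ρ l k / 2 ^ n) * (pauliString b k l * pauliString b i j) := by
      intro b
      rw [hre, Matrix.trace]
      simp only [Matrix.diag, Matrix.mul_apply, Finset.sum_div, Finset.sum_mul]
      exact Finset.sum_congr rfl fun k _ => Finset.sum_congr rfl fun l _ => by ring
    simp only [ofCoeff, Matrix.sum_apply, Matrix.smul_apply, smul_eq_mul, h3]
    rw [Finset.sum_comm]
    simp only [Finset.sum_comm (s := (Finset.univ : Finset (Label n))), ← Finset.mul_sum,
      sum_pauliString_mul, ite_and]
    simp [h2]

end QubitTomography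

namespace QubitTomography

/-! Everything rests on the columns of the design matrix being orthogonal (`designMatrix_gram`): the
least-squares estimator then becomes an explicit normalised sum of signs over independent
measurements (`coeffEstimator_eq`). Born's rule gives unbiasedness. For the variance, a squared sign
is the indicator that the setting observes `b`, and exactly `3 ^ numI b` settings do.

For the norm bound, the error `ρ̂ - ρ` is a sum `S` of independent centred Hermitian matrices `Y k`.
A single shot is a tensor product of site matrices with eigenvalues 2/3 and -1/3, so its square is
at most `(4/9)^n` and differences of two copies have square at most `4 (4/9)^n`.

Concentration comes from even trace moments and exchangeable pairs. Write `E tr S^(2p+2)` as the sum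
over `k` of `E tr (Y k * S^(2p+1))`, subtract from `Y k` an independent copy (of mean zero), and
average with the expression in which the two are exchanged. This produces `tr ((S - S') (S^(2p+1) -
S'^(2p+1)))`, where `S'` is `S` with one summand resampled. A trace mean value inequality bounds it
by `(S - S')^2` against even powers, which gives a recursion for the moments (`moment_succ_le`) and
then `E ‖S‖^(2p) ≤ 2^n (4 s p)^p` with `s = (4/3)^n / m`. Markov's inequality with `p = ⌈L⌉`, where
`L = n log 2 - log ε`, finishes. -/

/-! ### Scalar power inequalities. -/

/-- Rearrangement: `|a|^i - |b|^i` and `|a|^j - |b|^j` have the same sign. Even total degree lets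
the absolute values be dropped on the right. -/
theorem pow_mul_pow_add_le {a b : ℝ} {i j : ℕ} (h : Even (i + j)) :
    a ^ i * b ^ j + a ^ j * b ^ i ≤ a ^ (i + j) + b ^ (i + j) := by
  have h1 : a ^ i * b ^ j ≤ |a| ^ i * |b| ^ j := by
    rw [← abs_pow, ← abs_pow, ← abs_mul]; exact le_abs_self _
  have h2 : a ^ j * b ^ i ≤ |a| ^ j * |b| ^ i := by
    rw [← abs_pow, ← abs_pow, ← abs_mul]; exact le_abs_self _
  have h3 : 0 ≤ (|a| ^ i - |b| ^ i) * (|a| ^ j - |b| ^ j) := by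
    rcases le_total |a| |b| with hab | hab
    · exact mul_nonneg_of_nonpos_of_nonpos
        (sub_nonpos.2 (pow_le_pow_left₀ (abs_nonneg a) hab i))
        (sub_nonpos.2 (pow_le_pow_left₀ (abs_nonneg a) hab j))
    · exact mul_nonneg (sub_nonneg.2 (pow_le_pow_left₀ (abs_nonneg b) hab i))
        (sub_nonneg.2 (pow_le_pow_left₀ (abs_nonneg b) hab j))
  rw [← h.pow_abs a, ← h.pow_abs b, pow_add, pow_add]
  nlinarith

/-- Factor the difference of powers as a geometric sum and pair the term `i` with the term `2p - i`;
each of the `2p + 1` pairs is bounded by the rearrangement inequality, and the pairing counts the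
sum twice. -/
theorem sub_mul_pow_sub_pow_le (a b : ℝ) (p : ℕ) :
    (a - b) * (a ^ (2 * p + 1) - b ^ (2 * p + 1)) ≤
      (2 * p + 1) / 2 * ((a - b) ^ 2 * (a ^ (2 * p) + b ^ (2 * p))) := by
  have hg : (∑ i ∈ Finset.range (2 * p + 1), a ^ i * b ^ (2 * p - i)) * (a - b) =
      a ^ (2 * p + 1) - b ^ (2 * p + 1) := by
    simpa using (Commute.all a b).geom_sum₂_mul (2 * p + 1)
  have hr : ∑ i ∈ Finset.range (2 * p + 1), a ^ i * b ^ (2 * p - i) =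
      ∑ i ∈ Finset.range (2 * p + 1), a ^ (2 * p - i) * b ^ i := by
    rw [← Finset.sum_range_reflect]
    refine Finset.sum_congr rfl fun i hi => ?_
    have : i < 2 * p + 1 := Finset.mem_range.1 hi
    rw [show 2 * p + 1 - 1 - i = 2 * p - i by omega, show 2 * p - (2 * p - i) = i by omega]
  have hs : 2 * ∑ i ∈ Finset.range (2 * p + 1), a ^ i * b ^ (2 * p - i) ≤
      (2 * p + 1) * (a ^ (2 * p) + b ^ (2 * p)) := by
    rw [two_mul]
    nth_rewrite 2 [hr]
    rw [← Finset.sum_add_distrib]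
    refine (Finset.sum_le_card_nsmul _ _ (a ^ (2 * p) + b ^ (2 * p)) fun i hi => ?_).trans ?_
    · have : i < 2 * p + 1 := Finset.mem_range.1 hi
      have hi' : i + (2 * p - i) = 2 * p := by omega
      have := pow_mul_pow_add_le (a := a) (b := b) (i := i) (j := 2 * p - i)
        (by rw [hi']; exact even_two_mul p)
      rwa [hi'] at this
    · simp [mul_add]
  rw [← hg]
  nlinarith [mul_le_mul_of_nonneg_left hs (sq_nonneg (a - b))]

/-! ### Trace inequalities for pairs of Hermitian matrices. -/

section Trace

variable {d : Type*} [Fintype d] [DecidableEq d]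

theorem _root_.Matrix.IsHermitian.pow_eq_conj_diagonal {A : Matrix d d ℂ} (hA : A.IsHermitian)
    (i : ℕ) : A ^ i = (hA.eigenvectorUnitary : Matrix d d ℂ) *
      Matrix.diagonal (fun k => ((hA.eigenvalues k ^ i : ℝ) : ℂ)) *
        star (hA.eigenvectorUnitary : Matrix d d ℂ) := by
  have h : A ^ i = (Unitary.conjStarAlgAut ℂ _ hA.eigenvectorUnitary
      (Matrix.diagonal (RCLike.ofReal ∘ hA.eigenvalues))) ^ i := by
    rw [← hA.spectral_theorem]
  rw [h, ← map_pow, Matrix.diagonal_pow, Unitary.conjStarAlgAut_apply]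
  congr 3
  funext k
  simp

/-- The joint spectral expansion of `tr (Aⁱ Bʲ)` for Hermitian `A` and `B`. -/
theorem trace_pow_mul_pow_eq_sum {A B : Matrix d d ℂ} (hA : A.IsHermitian) (hB : B.IsHermitian) :
    ∃ g : d → d → ℝ, (∀ k l, 0 ≤ g k l) ∧ ∀ i j : ℕ, (A ^ i * B ^ j).trace.re =
      ∑ k, ∑ l, g k l * (hA.eigenvalues k ^ i * hB.eigenvalues l ^ j) := by
  set U : Matrix d d ℂ := (hA.eigenvectorUnitary : Matrix d d ℂ)
  set V : Matrix d d ℂ := (hB.eigenvectorUnitary : Matrix d d ℂ)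
  -- The weights are the squared overlaps of the two eigenbases. They do not depend on the
  -- exponents, so a scalar inequality between pairs of eigenvalues can be summed against them.
  refine ⟨fun k l => Complex.normSq ((star U * V) k l), fun k l => Complex.normSq_nonneg _, ?_⟩
  intro i j
  set D := Matrix.diagonal (fun k => ((hA.eigenvalues k ^ i : ℝ) : ℂ)) with hD
  set E := Matrix.diagonal (fun k => ((hB.eigenvalues k ^ j : ℝ) : ℂ)) with hE
  have h : (A ^ i * B ^ j).trace = (D * (star U * V) * E * star (star U * V)).trace := by
    rw [hA.pow_eq_conj_diagonal, hB.pow_eq_conj_diagonal, star_mul, star_star]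
    rw [show U * D * star U * (V * E * star V) = U * (D * (star U * V) * E * star V) by
      simp only [Matrix.mul_assoc], Matrix.trace_mul_comm]
    simp only [Matrix.mul_assoc]
  rw [h, Matrix.trace, Complex.re_sum]
  refine Finset.sum_congr rfl fun k _ => ?_
  rw [Matrix.diag_apply, Matrix.mul_apply, Complex.re_sum]
  refine Finset.sum_congr rfl fun l _ => ?_
  rw [hD, hE, Matrix.mul_diagonal, Matrix.diagonal_mul, Matrix.star_apply]
  rw [show ∀ x z y : ℂ, x * z * y * star z = x * y * (z * star z) by intros; ring]
  rw [Complex.star_def, Complex.mul_conj, ← Complex.ofReal_mul, ← Complex.ofReal_mul,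
    Complex.ofReal_re]
  ring

/-- A mean value inequality for the trace. -/
theorem trace_sub_mul_pow_sub_pow_le {A B : Matrix d d ℂ} (hA : A.IsHermitian)
    (hB : B.IsHermitian) (p : ℕ) :
    ((A - B) * (A ^ (2 * p + 1) - B ^ (2 * p + 1))).trace.re ≤
      (2 * p + 1) / 2 * ((A - B) ^ 2 * (A ^ (2 * p) + B ^ (2 * p))).trace.re := by
  obtain ⟨g, hg, h⟩ := trace_pow_mul_pow_eq_sum hA hB
  have h1 : ((A - B) * (A ^ (2 * p + 1) - B ^ (2 * p + 1))).trace.re =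
      ∑ k, ∑ l, g k l * ((hA.eigenvalues k - hB.eigenvalues l) *
        (hA.eigenvalues k ^ (2 * p + 1) - hB.eigenvalues l ^ (2 * p + 1))) := by
    have : ((A - B) * (A ^ (2 * p + 1) - B ^ (2 * p + 1))).trace.re =
        (A ^ (2 * p + 2) * B ^ 0).trace.re - (A ^ 1 * B ^ (2 * p + 1)).trace.re
          - (A ^ (2 * p + 1) * B ^ 1).trace.re + (A ^ 0 * B ^ (2 * p + 2)).trace.re := by
      rw [sub_mul, mul_sub, mul_sub, ← pow_succ', ← pow_succ', Matrix.trace_sub,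
        Matrix.trace_sub, Matrix.trace_sub, Matrix.trace_mul_comm B]
      simp only [Complex.sub_re, pow_zero, mul_one, one_mul, pow_one]
      ring
    rw [this, h, h, h, h]
    simp only [← Finset.sum_sub_distrib, ← Finset.sum_add_distrib]
    refine Finset.sum_congr rfl fun k _ => Finset.sum_congr rfl fun l _ => ?_
    ring
  have h2 : ((A - B) ^ 2 * (A ^ (2 * p) + B ^ (2 * p))).trace.re =
      ∑ k, ∑ l, g k l * ((hA.eigenvalues k - hB.eigenvalues l) ^ 2 *
        (hA.eigenvalues k ^ (2 * p) + hB.eigenvalues l ^ (2 * p))) := by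
    have : ((A - B) ^ 2 * (A ^ (2 * p) + B ^ (2 * p))).trace.re =
        (A ^ (2 * p + 2) * B ^ 0).trace.re + (A ^ 2 * B ^ (2 * p)).trace.re
          - 2 * (A ^ (2 * p + 1) * B ^ 1).trace.re - 2 * (A ^ 1 * B ^ (2 * p + 1)).trace.re
          + (A ^ (2 * p) * B ^ 2).trace.re + (A ^ 0 * B ^ (2 * p + 2)).trace.re := by
      -- Although `A` and `B` need not commute, each word of this expansion is, up to cyclic
      -- rotation, a power of `A` times a power of `B`, so the trace equals that of the commutative
      -- expansion.
      have e : (A - B) ^ 2 * (A ^ (2 * p) + B ^ (2 * p)) =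
          A ^ (2 * p + 2) + A ^ 2 * B ^ (2 * p) - A * (B * A ^ (2 * p))
            - A * B ^ (2 * p + 1) - B * A ^ (2 * p + 1) - B * (A * B ^ (2 * p))
            + B ^ 2 * A ^ (2 * p) + B ^ (2 * p + 2) := by
        simp only [pow_succ' _ (2 * p), pow_succ' _ (2 * p + 1), sq]
        noncomm_ring
      rw [e]
      simp only [Matrix.trace_add, Matrix.trace_sub]
      rw [Matrix.trace_mul_comm A (B * A ^ (2 * p)), Matrix.mul_assoc, ← pow_succ,
        Matrix.trace_mul_comm B (A ^ (2 * p + 1)),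
        Matrix.trace_mul_comm B (A * B ^ (2 * p)), Matrix.mul_assoc, ← pow_succ,
        Matrix.trace_mul_comm (B ^ 2)]
      simp only [Complex.sub_re, Complex.add_re, pow_zero, mul_one, one_mul, pow_one]
      ring
    rw [this, h, h, h, h, h, h]
    simp only [← Finset.sum_sub_distrib, ← Finset.sum_add_distrib, Finset.mul_sum]
    refine Finset.sum_congr rfl fun k _ => Finset.sum_congr rfl fun l _ => ?_
    ring
  rw [h1, h2, Finset.mul_sum]
  refine Finset.sum_le_sum fun k _ => ?_
  rw [Finset.mul_sum]
  refine Finset.sum_le_sum fun l _ => ?_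
  refine (mul_le_mul_of_nonneg_left (sub_mul_pow_sub_pow_le _ _ p) (hg k l)).trans_eq ?_
  ring

/-- By cyclicity this is the trace of `A^p * M * A^p`, which is positive semidefinite. It lets an
operator bound on `(S - S')^2` be used against even powers inside a trace. -/
theorem trace_mul_pow_two_mul_nonneg {M A : Matrix d d ℂ} (hM : M.PosSemidef) (hA : A.IsHermitian)
    (p : ℕ) : 0 ≤ (M * A ^ (2 * p)).trace.re := by
  have h : (M * A ^ (2 * p)).trace = ((A ^ p)ᴴ * M * A ^ p).trace := by
    rw [(hA.pow p).eq, Matrix.trace_mul_comm, two_mul, pow_add, Matrix.mul_assoc,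
      Matrix.trace_mul_comm (A ^ p), Matrix.mul_assoc]
  rw [h]
  exact (Complex.le_def.1 (hM.conjTranspose_mul_mul_same (A ^ p)).trace_nonneg).1

/-- The norm is attained at some `|eigenvalue|`, whose even power is one nonnegative summand of the
trace. -/
theorem opNorm_pow_le_trace {n : ℕ} {A : QMatrix n} (hA : A.IsHermitian) (p : ℕ) :
    opNorm A ^ (2 * p) ≤ (A ^ (2 * p)).trace.re := by
  open scoped Matrix.Norms.L2Operator in
  have hle : opNorm A ≤ ‖hA.eigenvalues‖ := by
    have h := congrArg norm (hA.pow_eq_conj_diagonal 1)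
    rw [pow_one, CStarRing.norm_mul_mem_unitary _ (Unitary.star_mem hA.eigenvectorUnitary.2),
      CStarRing.norm_mem_unitary_mul _ hA.eigenvectorUnitary.2, Matrix.l2_opNorm_diagonal] at h
    refine h.le.trans ((pi_norm_le_iff_of_nonneg (norm_nonneg _)).2 fun k => ?_)
    rw [pow_one, Complex.norm_real]
    exact norm_le_pi_norm hA.eigenvalues k
  obtain ⟨k, hk⟩ : ∃ k, ‖hA.eigenvalues‖ = |hA.eigenvalues k| := by
    obtain ⟨k, -, hk⟩ := Finset.exists_mem_eq_sup Finset.univ Finset.univ_nonempty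
      (fun k => ‖hA.eigenvalues k‖₊)
    exact ⟨k, congrArg NNReal.toReal ((Pi.nnnorm_def _).trans hk)⟩
  have htr : (A ^ (2 * p)).trace.re = ∑ k, hA.eigenvalues k ^ (2 * p) := by
    rw [hA.pow_eq_conj_diagonal, Matrix.trace_mul_comm, ← Matrix.mul_assoc,
      Unitary.coe_star_mul_self, Matrix.one_mul, Matrix.trace_diagonal, Complex.re_sum]
    simp only [Complex.ofReal_re]
  rw [htr]
  calc opNorm A ^ (2 * p) ≤ |hA.eigenvalues k| ^ (2 * p) :=
        pow_le_pow_left₀ (norm_nonneg _) (hle.trans_eq hk) _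
    _ = hA.eigenvalues k ^ (2 * p) := (even_two_mul p).pow_abs _
    _ ≤ _ := Finset.single_le_sum (f := fun k => hA.eigenvalues k ^ (2 * p))
        (fun i _ => (even_two_mul p).pow_nonneg _) (Finset.mem_univ k)

end Trace

/-! ### Moment recursion by exchangeable pairs. -/

section Moments

variable {K O d : Type*} [Fintype K] [DecidableEq K] [Fintype O] [Fintype d] [DecidableEq d]

/-- The invariance of independent data under exchanging one of them with an independent copy. -/
theorem sum_prod_mul_exchange (w : K → O → ℝ) (k : K) (F : (K → O) → O → ℝ) :
    ∑ x : K → O, ∑ y, (∏ l, w l (x l)) * w k y * F x y =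
      ∑ x : K → O, ∑ y, (∏ l, w l (x l)) * w k y * F (Function.update x k y) (x k) := by
  -- Swapping the `k`-th datum with its copy is an involution that preserves the product weight.
  have hinv : Function.Involutive
      (fun q : (K → O) × O => (Function.update q.1 k q.2, q.1 k)) := by
    rintro ⟨x, y⟩
    simp
  rw [← Fintype.sum_prod_type', ← Fintype.sum_prod_type', ← Equiv.sum_comp hinv.toPerm]
  refine Finset.sum_congr rfl fun q _ => ?_
  obtain ⟨x, y⟩ := q
  simp only [Function.Involutive.coe_toPerm]
  congr 1
  rw [← Finset.mul_prod_erase Finset.univ _ (Finset.mem_univ k),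
    ← Finset.mul_prod_erase Finset.univ (fun l => w l (x l)) (Finset.mem_univ k),
    Function.update_self]
  rw [Finset.prod_congr rfl (g := fun l => w l (x l)) fun l hl => by
    rw [Function.update_of_ne (Finset.ne_of_mem_erase hl)]]
  ring

/-- One factor `S` is split into its summands, and each `Y k` is handled by resampling the `k`-th
datum only: `S` then changes by exactly `Y k (x k) - Y k y`, whose square is at most `c`. -/
theorem moment_succ_le {w : K → O → ℝ} (hw : ∀ k o, 0 ≤ w k o) (hw1 : ∀ k, ∑ o, w k o = 1)
    {Y : K → O → Matrix d d ℂ} (hY : ∀ k o, (Y k o).IsHermitian)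
    (hY0 : ∀ k, ∑ o, (w k o : ℂ) • Y k o = 0) {c : ℝ}
    (hc : ∀ k o o', ((c : ℂ) • (1 : Matrix d d ℂ) - (Y k o - Y k o') ^ 2).PosSemidef) (p : ℕ) :
    ∑ x : K → O, (∏ l, w l (x l)) * ((∑ k, Y k (x k)) ^ (2 * (p + 1))).trace.re ≤
      Fintype.card K * c * ((2 * p + 1) / 2) *
        ∑ x : K → O, (∏ l, w l (x l)) * ((∑ k, Y k (x k)) ^ (2 * p)).trace.re := by
  set S : (K → O) → Matrix d d ℂ := fun x => ∑ k, Y k (x k) with hS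
  have hSH : ∀ x, (S x).IsHermitian := fun x => by
    simp only [hS, Matrix.IsHermitian, Matrix.conjTranspose_sum, (hY _ _).eq]
  set W : (K → O) → ℝ := fun x => ∏ l, w l (x l) with hW
  have hW0 : ∀ x, 0 ≤ W x := fun x => Finset.prod_nonneg fun l _ => hw _ _
  set M := ∑ x, W x * ((S x) ^ (2 * p)).trace.re with hM
  have hupd : ∀ x k y, S x - S (Function.update x k y) = Y k (x k) - Y k y := by
    intro x k y
    simp only [hS, ← Finset.sum_sub_distrib]
    rw [Finset.sum_eq_single k]
    · simp
    · intro l _ hl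
      simp [Function.update_of_ne hl]
    · simp
  have hk : ∀ k, ∑ x, W x * (Y k (x k) * S x ^ (2 * p + 1)).trace.re ≤
      c * ((2 * p + 1) / 2) * M := by
    intro k
    set D := ∑ x, W x * (Y k (x k) * S x ^ (2 * p + 1)).trace.re
    have h1 : D = ∑ x, ∑ y, W x * w k y *
        ((Y k (x k) - Y k y) * S x ^ (2 * p + 1)).trace.re := by
      refine Finset.sum_congr rfl fun x _ => ?_
      have : ∑ y, w k y * (Y k y * S x ^ (2 * p + 1)).trace.re = 0 := by
        have h := congrArg (fun N => (N * S x ^ (2 * p + 1)).trace.re) (hY0 k)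
        simpa [Finset.sum_mul, Matrix.trace_sum, Matrix.trace_smul, Complex.re_sum] using h
      simp only [sub_mul, Matrix.trace_sub, Complex.sub_re, mul_sub, Finset.sum_sub_distrib,
        mul_assoc]
      simp only [← Finset.mul_sum]
      rw [this, ← Finset.sum_mul, hw1]
      ring
    have h2 := h1
    rw [sum_prod_mul_exchange] at h2
    have hMexp : M = ∑ x, ∑ y, W x * w k y * (S x ^ (2 * p)).trace.re := by
      refine Finset.sum_congr rfl fun x _ => ?_
      simp only [← Finset.mul_sum, ← Finset.sum_mul, hw1, mul_one]
    have hMexp2 := hMexp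
    rw [sum_prod_mul_exchange] at hMexp2
    -- Adding the original and the exchanged form of `D` gives the antisymmetric product required by
    -- the mean value inequality; `M` is doubled likewise, so that `A` and `B` enter symmetrically.
    have hDD : D + D ≤ c * ((2 * p + 1) / 2) * (M + M) := by
      nth_rewrite 1 [h1]
      rw [h2]
      nth_rewrite 1 [hMexp]
      rw [hMexp2]
      simp only [Function.update_self, ← Finset.sum_add_distrib, Finset.mul_sum]
      refine Finset.sum_le_sum fun x _ => Finset.sum_le_sum fun y _ => ?_
      set A := S x
      set B := S (Function.update x k y)
      have hAB : A - B = Y k (x k) - Y k y := hupd x k y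
      have t := trace_sub_mul_pow_sub_pow_le (hSH x) (hSH (Function.update x k y)) p
      have q : ∀ C : Matrix d d ℂ, C.IsHermitian →
          ((A - B) ^ 2 * C ^ (2 * p)).trace.re ≤ c * (C ^ (2 * p)).trace.re := by
        intro C hC
        have := trace_mul_pow_two_mul_nonneg (hc k (x k) y) hC p
        rw [← hAB, sub_mul, Matrix.trace_sub, Complex.sub_re, smul_mul_assoc, one_mul,
          Matrix.trace_smul, smul_eq_mul, Complex.re_ofReal_mul] at this
        linarith
      have qA := q A (hSH x)
      have qB := q B (hSH _)
      have hww : 0 ≤ W x * w k y := mul_nonneg (hW0 x) (hw k y)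
      have e1 : ((Y k (x k) - Y k y) * A ^ (2 * p + 1)).trace.re +
          ((Y k y - Y k (x k)) * B ^ (2 * p + 1)).trace.re =
          ((A - B) * (A ^ (2 * p + 1) - B ^ (2 * p + 1))).trace.re := by
        rw [← hAB, ← neg_sub (Y k (x k)), ← hAB, mul_sub, neg_mul, Matrix.trace_sub,
          Matrix.trace_neg, Complex.sub_re, Complex.neg_re]
        ring
      rw [mul_add, Matrix.trace_add, Complex.add_re] at t
      have hp : (0 : ℝ) ≤ (2 * p + 1) / 2 := by positivity
      calc _ = W x * w k y * (((Y k (x k) - Y k y) * A ^ (2 * p + 1)).trace.re +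
              ((Y k y - Y k (x k)) * B ^ (2 * p + 1)).trace.re) := by ring
        _ ≤ W x * w k y * ((2 * p + 1) / 2 * (c * (A ^ (2 * p)).trace.re +
              c * (B ^ (2 * p)).trace.re)) := by
            rw [e1]
            exact mul_le_mul_of_nonneg_left
              (t.trans (mul_le_mul_of_nonneg_left (add_le_add qA qB) hp)) hww
        _ = _ := by ring
    linarith
  calc ∑ x, W x * (S x ^ (2 * (p + 1))).trace.re
      = ∑ k, ∑ x, W x * (Y k (x k) * S x ^ (2 * p + 1)).trace.re := by
        rw [Finset.sum_comm]
        refine Finset.sum_congr rfl fun x _ => ?_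
        rw [← Finset.mul_sum, ← Complex.re_sum, ← Matrix.trace_sum, ← Finset.sum_mul,
          show 2 * (p + 1) = 2 * p + 1 + 1 by ring, pow_succ' (S x)]
    _ ≤ ∑ _k : K, c * ((2 * p + 1) / 2) * M := Finset.sum_le_sum fun k _ => hk k
    _ = _ := by
        simp
        ring

theorem moment_le {w : K → O → ℝ} (hw : ∀ k o, 0 ≤ w k o) (hw1 : ∀ k, ∑ o, w k o = 1)
    {Y : K → O → Matrix d d ℂ} (hY : ∀ k o, (Y k o).IsHermitian)
    (hY0 : ∀ k, ∑ o, (w k o : ℂ) • Y k o = 0) {c : ℝ} (hc0 : 0 ≤ c)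
    (hc : ∀ k o o', ((c : ℂ) • (1 : Matrix d d ℂ) - (Y k o - Y k o') ^ 2).PosSemidef) (p : ℕ) :
    ∑ x : K → O, (∏ l, w l (x l)) * ((∑ k, Y k (x k)) ^ (2 * p)).trace.re ≤
      Fintype.card d * (Fintype.card K * c * p) ^ p := by
  -- With `p` fixed, every recursion factor `(2r + 1)/2` with `r < p` is at most `p`, which replaces
  -- the product of the factors by a power.
  have key : ∀ r ≤ p, ∑ x : K → O, (∏ l, w l (x l)) * ((∑ k, Y k (x k)) ^ (2 * r)).trace.re ≤
      Fintype.card d * (Fintype.card K * c * p) ^ r := by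
    intro r
    induction r with
    | zero =>
      intro _
      simp only [mul_zero, pow_zero, Matrix.trace_one, Complex.natCast_re, mul_one]
      rw [← Finset.sum_mul, ← Fintype.prod_sum]
      simp [hw1]
    | succ r ih =>
      intro hr
      refine (moment_succ_le hw hw1 hY hY0 hc r).trans ?_
      have hr' : ((2 * r + 1) / 2 : ℝ) ≤ p := by
        have : ((r + 1 : ℕ) : ℝ) ≤ p := by exact_mod_cast hr
        push_cast at this
        linarith
      have hC : 0 ≤ Fintype.card K * c := by positivity
      calc _ ≤ Fintype.card K * c * ((2 * r + 1) / 2) *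
            (Fintype.card d * (Fintype.card K * c * p) ^ r) :=
            mul_le_mul_of_nonneg_left (ih (by omega)) (by positivity)
        _ ≤ Fintype.card K * c * p * (Fintype.card d * (Fintype.card K * c * p) ^ r) := by
            gcongr
        _ = _ := by ring
  exact key p le_rfl

end Moments

/-! ### Tensor products and measurement projectors. -/

theorem sum_axis {M : Type*} [AddCommMonoid M] (f : Axis → M) :
    ∑ t, f t = f .x + f .y + f .z := by
  have hA : (Finset.univ : Finset Axis) = {Axis.x, Axis.y, Axis.z} := rfl
  rw [hA, Finset.sum_insert (by simp), Finset.sum_insert (by simp), Finset.sum_singleton, add_assoc]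

theorem sum_units_int {M : Type*} [AddCommMonoid M] (f : ℤˣ → M) : ∑ s, f s = f 1 + f (-1) := by
  rw [UnitsInt.univ, Finset.sum_insert (by decide), Finset.sum_singleton]

section Tensor

variable {n : ℕ}

theorem tensor_sum {ι : Type*} [Fintype ι] (f : Fin n → ι → Matrix (Fin 2) (Fin 2) ℂ) :
    tensor (fun k => ∑ s, f k s) = ∑ x : Fin n → ι, tensor fun k => f k (x k) := by
  ext i j
  simp only [tensor, Matrix.of_apply, Matrix.sum_apply]
  exact Fintype.prod_sum fun k s => f k s (i k) (j k)

theorem tensor_smul (c : Fin n → ℂ) (A : Fin n → Matrix (Fin 2) (Fin 2) ℂ) :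
    tensor (fun k => c k • A k) = (∏ k, c k) • tensor A := by
  ext i j
  simp [tensor, Finset.prod_mul_distrib]

theorem tensor_mul (A B : Fin n → Matrix (Fin 2) (Fin 2) ℂ) :
    tensor A * tensor B = tensor fun k => A k * B k := by
  ext i j
  simp only [tensor, Matrix.mul_apply, Matrix.of_apply, ← Finset.prod_mul_distrib]
  exact (Fintype.prod_sum fun k s => A k (i k) s * B k s (j k)).symm

theorem tensor_one : tensor (fun _ : Fin n => (1 : Matrix (Fin 2) (Fin 2) ℂ)) = 1 := by
  ext i j
  simp only [tensor, Matrix.of_apply, Matrix.one_apply, Finset.prod_ite_zero, Finset.prod_const_one,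
    funext_iff, Finset.mem_univ, true_imp_iff]

theorem tensor_conjTranspose (A : Fin n → Matrix (Fin 2) (Fin 2) ℂ) :
    (tensor A)ᴴ = tensor fun k => (A k)ᴴ := by
  ext i j
  simp [tensor]

theorem outcomeProj_posSemidef (a : Setting n) (r : Outcome n) : (outcomeProj a r).PosSemidef := by
  have h : outcomeProj a r = (outcomeProj a r)ᴴ * outcomeProj a r := by
    rw [outcomeProj, tensor_conjTranspose, tensor_mul]
    congr 1
    funext k
    rw [(eigenProj_spec (a k) (r k)).1.eq, (eigenProj_spec (a k) (r k)).2.1]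
  rw [h]
  exact Matrix.posSemidef_conjTranspose_mul_self _

end Tensor

/-- The contribution of one qubit to an entry of the design matrix. -/
def siteFactor (o : Option Axis) (t : Axis) (s : ℤˣ) : ℝ :=
  if o = none then 1 else (s : ℤ) * (if o = some t then 1 else 0)

/-- Whether the measurement setting `a` observes the Pauli string `b`. -/
def observes {n : ℕ} (a : Setting n) (b : Label n) : ℝ :=
  ∏ j, if b j = none ∨ b j = some (a j) then 1 else 0

/-! ### The design matrix and the single-shot estimator. -/

section Design

variable {n : ℕ}

theorem designMatrix_apply (r : Outcome n) (a : Setting n) (b : Label n) :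
    designMatrix n (r, a) b = ∏ j, siteFactor (b j) (a j) (r j) := by
  simp only [designMatrix, Matrix.of_apply, siteFactor, Finset.prod_filter, ne_eq, ite_not]

theorem prod_ite_none (b : Label n) :
    ∏ j, (if b j = none then (3 : ℝ) else 1) = 3 ^ numI b := by
  rw [Finset.prod_ite, Finset.prod_const, Finset.prod_const_one, mul_one, numI]

/-- Entries are products over sites, so the Gram matrix factorises. Each site contributes a factor 2
for the signs, times 3 if the label is `I` there (every axis fits); different site labels cancel on
summing over the sign or never fit the same axis. -/
theorem designMatrix_gram :
    (designMatrix n)ᵀ * designMatrix n = Matrix.diagonal fun b => (3 : ℝ) ^ numI b * 2 ^ n := by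
  have h1 : ∀ o p : Option Axis, ∑ s, ∑ t, siteFactor o t s * siteFactor p t s =
      if o = p then (if o = none then 3 else 1) * 2 else 0 := by
    intro o p
    rw [sum_units_int, sum_axis, sum_axis]
    rcases o with _ | o <;> rcases p with _ | p
    · norm_num [siteFactor]
    · cases p <;> simp [siteFactor]
    · cases o <;> simp [siteFactor]
    · cases o <;> cases p <;> simp [siteFactor] <;> norm_num
  ext b c
  have h2 : ((designMatrix n)ᵀ * designMatrix n) b c =
      ∏ j, ∑ s, ∑ t, siteFactor (b j) t s * siteFactor (c j) t s := by
    rw [Matrix.mul_apply, Fintype.sum_prod_type, Fintype.prod_sum]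
    refine Finset.sum_congr rfl fun r _ => ?_
    rw [Fintype.prod_sum]
    refine Finset.sum_congr rfl fun a _ => ?_
    rw [Matrix.transpose_apply, designMatrix_apply, designMatrix_apply, Finset.prod_mul_distrib]
  rw [h2, Matrix.diagonal_apply]
  simp only [h1]
  split_ifs with h
  · subst h
    simp only [if_true, Finset.prod_mul_distrib, prod_ite_none]
    simp
  · obtain ⟨q, hq⟩ := Function.ne_iff.mp h
    exact Finset.prod_eq_zero (Finset.mem_univ q) (if_neg hq)

theorem coeffEstimator_eq {m : ℕ} (R : Setting n → Fin m → Outcome n) (b : Label n) :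
    coeffEstimator R b =
      1 / (3 ^ numI b * 2 ^ n * m) * ∑ p : Setting n × Fin m, designMatrix n (R p.1 p.2, p.1) b := by
  have hinv : ((designMatrix n)ᵀ * designMatrix n)⁻¹ =
      Matrix.diagonal fun b => ((3 : ℝ) ^ numI b * 2 ^ n)⁻¹ := by
    refine Matrix.inv_eq_left_inv ?_
    rw [designMatrix_gram, Matrix.diagonal_mul_diagonal, ← Matrix.diagonal_one]
    congr 1
    funext b
    exact inv_mul_cancel₀ (by positivity)
  have hP : ((designMatrix n)ᵀ *ᵥ empiricalFreq R) b =
      1 / (m : ℝ) * ∑ p : Setting n × Fin m, designMatrix n (R p.1 p.2, p.1) b := by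
    rw [Matrix.mulVec, dotProduct, Fintype.sum_prod_type_right, Fintype.sum_prod_type,
      Finset.mul_sum]
    refine Finset.sum_congr rfl fun a _ => ?_
    simp only [empiricalFreq, Matrix.transpose_apply, Finset.mul_sum]
    rw [Finset.sum_comm]
    refine Finset.sum_congr rfl fun i _ => ?_
    rw [Finset.sum_eq_single (R a i)]
    · simp [mul_comm]
    · intro r _ hr
      simp [hr.symm]
    · simp
  rw [coeffEstimator, hinv, Matrix.mulVec_diagonal, hP]
  field_simp

theorem sum_observes (b : Label n) : ∑ a, observes a b = 3 ^ numI b := by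
  rw [← prod_ite_none]
  simp only [observes]
  rw [← Fintype.prod_sum fun j t => if b j = none ∨ b j = some t then (1 : ℝ) else 0]
  refine Finset.prod_congr rfl fun j _ => ?_
  rw [sum_axis]
  rcases b j with _ | t
  · norm_num
  · cases t <;> simp

theorem designMatrix_sq (r : Outcome n) (a : Setting n) (b : Label n) :
    designMatrix n (r, a) b ^ 2 = observes a b := by
  rw [designMatrix_apply, ← Finset.prod_pow, observes]
  refine Finset.prod_congr rfl fun j _ => ?_
  rcases Int.units_eq_one_or (r j) with h | h <;> rcases b j with _ | t <;>
    simp [siteFactor, h]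

/-- The spectral decomposition of `σ_b` in the eigenbasis of the setting, when that setting observes
`b`. -/
theorem sum_designMatrix_smul_outcomeProj (a : Setting n) (b : Label n) :
    ∑ r, (designMatrix n (r, a) b : ℂ) • outcomeProj a r = (observes a b : ℂ) • pauliString b := by
  have h1 : ∀ (o : Option Axis) (t : Axis), ∑ s, (siteFactor o t s : ℂ) • eigenProj t s =
      ((if o = none ∨ o = some t then 1 else 0 : ℝ) : ℂ) • pauliI o := by
    intro o t
    rw [sum_units_int]
    rcases o with _ | u
    · simp only [siteFactor, eigenProj, pauliI]
      simp
      module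
    · by_cases h : u = t
      · subst h
        simp only [siteFactor, eigenProj, pauliI]
        simp
        module
      · simp [siteFactor, h]
  simp only [designMatrix_apply, outcomeProj, Complex.ofReal_prod, ← tensor_smul]
  rw [← tensor_sum fun k s => (siteFactor (b k) (a k) s : ℂ) • eigenProj (a k) s]
  simp only [h1, tensor_smul, observes, pauliString, Complex.ofReal_prod]

/-- The contribution of a single outcome `r` in the setting `a` to the linear estimator. -/
noncomputable def singleShot (a : Setting n) (r : Outcome n) : QMatrix n :=
  ofCoeff fun b => 1 / (3 ^ numI b * 2 ^ n) * designMatrix n (r, a) b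

theorem ofCoeff_isHermitian (c : Label n → ℝ) : (ofCoeff c).IsHermitian := by
  simp only [Matrix.IsHermitian, ofCoeff, Matrix.conjTranspose_sum, Matrix.conjTranspose_smul,
    (pauliString_isHermitian _).eq, Complex.star_def, Complex.conj_ofReal]

theorem linearEstimator_eq {m : ℕ} (R : Setting n → Fin m → Outcome n) :
    linearEstimator R = (1 / m : ℂ) • ∑ p : Setting n × Fin m, singleShot p.1 (R p.1 p.2) := by
  simp only [linearEstimator, singleShot, ofCoeff]
  rw [Finset.sum_comm, Finset.smul_sum]
  refine Finset.sum_congr rfl fun b _ => ?_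
  rw [← Finset.sum_smul, smul_smul, coeffEstimator_eq]
  congr 1
  push_cast
  rw [← Finset.mul_sum]
  ring

/-- The eigenvalues of the single-qubit estimator. -/
noncomputable def siteEigenvalue (s : ℤˣ) : ℝ := 1 / 6 + (s : ℤ) / 2

/-- The normalisation `3 ^ numI b * 2 ^ n` is itself a product over sites: 6 at an `I`, 2 elsewhere.
Only `I` and the measured axis survive at each site. -/
theorem singleShot_eq_tensor (a : Setting n) (r : Outcome n) :
    singleShot a r = tensor fun k =>
      (1 / 6 : ℂ) • (1 : Matrix (Fin 2) (Fin 2) ℂ) + (((r k : ℤ) : ℂ) / 2) • pauli (a k) := by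
  have h1 : ∀ (t : Axis) (s : ℤˣ), (1 / 6 : ℂ) • (1 : Matrix (Fin 2) (Fin 2) ℂ) +
      (((s : ℤ) : ℂ) / 2) • pauli t =
      ∑ o, ((1 / ((if o = none then 3 else 1) * 2) * siteFactor o t s : ℝ) : ℂ) • pauliI o := by
    intro t s
    rw [Fintype.sum_option, sum_axis]
    cases t <;> simp [siteFactor, pauliI] <;> module
  simp only [h1, tensor_sum, tensor_smul]
  rw [singleShot, ofCoeff]
  refine Finset.sum_congr rfl fun b _ => ?_
  rw [designMatrix_apply, ← prod_ite_none, pauliString, ← Complex.ofReal_prod]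
  congr 2
  rw [Finset.prod_mul_distrib, Finset.prod_div_distrib, Finset.prod_mul_distrib]
  simp

/-- The square is diagonal in the eigenbasis of the setting `a`, with eigenvalues that are products
of 4/9 and 1/9. -/
theorem singleShot_sq_le (a : Setting n) (r : Outcome n) :
    ((((4 / 9 : ℝ) ^ n : ℝ) : ℂ) • (1 : QMatrix n) - singleShot a r ^ 2).PosSemidef := by
  have hsq : ∀ (t : Axis) (u : ℤˣ),
      ((1 / 6 : ℂ) • (1 : Matrix (Fin 2) (Fin 2) ℂ) + (((u : ℤ) : ℂ) / 2) • pauli t) *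
        ((1 / 6 : ℂ) • (1 : Matrix (Fin 2) (Fin 2) ℂ) + (((u : ℤ) : ℂ) / 2) • pauli t) =
      ∑ s, ((siteEigenvalue (u * s) ^ 2 : ℝ) : ℂ) • eigenProj t s := by
    intro t u
    rw [sum_units_int]
    rcases Int.units_eq_one_or u with h | h <;> subst h <;> cases t <;> ext i j <;>
      fin_cases i <;> fin_cases j <;>
      simp [eigenProj, pauli, siteEigenvalue, Matrix.mul_apply, Matrix.one_apply] <;> ring_nf <;>
      simp [Complex.I_sq] <;> norm_num
  have hone : ∀ t : Axis, (1 : Matrix (Fin 2) (Fin 2) ℂ) = ∑ s, eigenProj t s := by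
    intro t
    rw [sum_units_int]
    simp only [eigenProj]
    simp
    module
  have h1 : singleShot a r ^ 2 =
      ∑ s, ((∏ k, siteEigenvalue (r k * s k) ^ 2 : ℝ) : ℂ) • outcomeProj a s := by
    rw [sq, singleShot_eq_tensor, tensor_mul]
    simp only [hsq, tensor_sum, tensor_smul, outcomeProj, Complex.ofReal_prod]
  have h2 : (1 : QMatrix n) = ∑ s, outcomeProj a s := by
    rw [← tensor_one, show (fun _ : Fin n => (1 : Matrix (Fin 2) (Fin 2) ℂ)) =
      fun k => ∑ s, eigenProj (a k) s from funext fun k => hone (a k), tensor_sum]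
    rfl
  rw [h1, h2, Finset.smul_sum, ← Finset.sum_sub_distrib]
  refine Matrix.posSemidef_sum _ fun s _ => ?_
  rw [← sub_smul, ← Complex.ofReal_sub]
  refine (outcomeProj_posSemidef a s).smul (Complex.zero_le_real.2 (sub_nonneg.2 ?_))
  calc ∏ k, siteEigenvalue (r k * s k) ^ 2 ≤ ∏ _k : Fin n, (4 / 9 : ℝ) := by
        refine Finset.prod_le_prod (fun k _ => sq_nonneg _) fun k _ => ?_
        rcases Int.units_eq_one_or (r k * s k) with h | h <;> rw [h] <;>
          norm_num [siteEigenvalue]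
    _ = (4 / 9) ^ n := by rw [Finset.prod_const, Finset.card_univ, Fintype.card_fin]

theorem singleShot_isHermitian (a : Setting n) (r : Outcome n) : (singleShot a r).IsHermitian :=
  ofCoeff_isHermitian _

theorem singleShot_sub_sq_le (a : Setting n) (r r' : Outcome n) :
    (((4 * (4 / 9 : ℝ) ^ n : ℝ) : ℂ) • (1 : QMatrix n) -
      (singleShot a r - singleShot a r') ^ 2).PosSemidef := by
  have h1 : ((singleShot a r + singleShot a r') ^ 2).PosSemidef := by
    have hH := (singleShot_isHermitian a r).add (singleShot_isHermitian a r')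
    have := Matrix.posSemidef_conjTranspose_mul_self (singleShot a r + singleShot a r')
    rwa [hH.eq, ← sq] at this
  have h2 : ∀ r, ((2 : ℂ) • ((((4 / 9 : ℝ) ^ n : ℝ) : ℂ) • (1 : QMatrix n) -
      singleShot a r ^ 2)).PosSemidef := fun r =>
    (singleShot_sq_le a r).smul (by norm_num)
  -- Parallelogram identity: `2 X^2 + 2 X'^2 - (X - X')^2 = (X + X')^2`.
  convert ((h2 r).add (h2 r')).add h1 using 1
  simp only [sq, add_mul, mul_add, sub_mul, mul_sub]
  push_cast
  module

end Design

/-! ### Expectations of finitely valued data, and a numerical bound. -/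

section FiniteValued

variable {Ω X : Type*} [MeasurableSpace Ω] {μ : Measure Ω} [IsProbabilityMeasure μ]
  [Fintype X] [MeasurableSpace X] [MeasurableSingletonClass X] {Q : Ω → X}

theorem memLp_comp_of_fintype (hQ : Measurable Q) (F : X → ℝ) (q : ENNReal) :
    MemLp (fun ω => F (Q ω)) q μ := by
  refine MemLp.of_bound ((measurable_of_countable F).comp hQ).aestronglyMeasurable
    (∑ x, ‖F x‖) (ae_of_all _ fun ω => ?_)
  exact Finset.single_le_sum (f := fun x => ‖F x‖) (fun _ _ => norm_nonneg _)
    (Finset.mem_univ (Q ω))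

theorem integrable_comp_of_fintype (hQ : Measurable Q) (F : X → ℝ) :
    Integrable (fun ω => F (Q ω)) μ :=
  memLp_one_iff_integrable.1 (memLp_comp_of_fintype hQ F 1)

theorem integral_comp_eq_sum (hQ : Measurable Q) (F : X → ℝ) :
    ∫ ω, F (Q ω) ∂μ = ∑ x, μ.real {ω | Q ω = x} * F x := by
  have hF : Measurable F := measurable_of_countable F
  have : IsProbabilityMeasure (μ.map Q) := Measure.isProbabilityMeasure_map hQ.aemeasurable
  rw [← integral_map (f := F) hQ.aemeasurable hF.aestronglyMeasurable, integral_fintype]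
  · refine Finset.sum_congr rfl fun x _ => ?_
    rw [map_measureReal_apply hQ (measurableSet_singleton x), smul_eq_mul]
    rfl
  · exact Integrable.of_finite

theorem sum_measureReal_eq_one (hQ : Measurable Q) : ∑ x, μ.real {ω | Q ω = x} = 1 := by
  have := integral_comp_eq_sum (μ := μ) hQ fun _ => 1
  simpa using this.symm

end FiniteValued

theorem measureReal_joint_eq_prod {Ω K O : Type*} [MeasurableSpace Ω] {μ : Measure Ω} [Fintype K]
    [MeasurableSpace O] [MeasurableSingletonClass O] {f : K → Ω → O} (hf : iIndepFun f μ)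
    (x : K → O) : μ.real {ω | (fun k => f k ω) = x} = ∏ k, μ.real {ω | f k ω = x k} := by
  have h := hf.measure_inter_preimage_eq_mul Finset.univ (sets := fun k => {x k})
    fun k _ => measurableSet_singleton _
  have e : {ω | (fun k => f k ω) = x} = ⋂ k ∈ (Finset.univ : Finset K), f k ⁻¹' {x k} := by
    ext ω
    simp [funext_iff]
  simp only [measureReal_def]
  rw [e, h, ENNReal.toReal_prod]
  rfl

/-- With `p = ⌈L⌉`, the ratio `4 s p / (32 s L)` in Markov's inequality must be at most `1/e`. As `p
< L + 1`, this follows from `e (L + 1) ≤ 8 L`, which already holds at `L = log 2`. -/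
theorem le_exp_neg_one_mul {L : ℝ} (hL : Real.log 2 ≤ L) : (⌈L⌉₊ : ℝ) ≤ 8 * L * Real.exp (-1) := by
  have h2 := Real.log_two_gt_d9
  have he := Real.exp_one_lt_d9
  have hp : (⌈L⌉₊ : ℝ) < L + 1 := Nat.ceil_lt_add_one (by linarith)
  rw [Real.exp_neg, ← div_eq_mul_inv, le_div_iff₀ (Real.exp_pos 1)]
  have : (⌈L⌉₊ : ℝ) * Real.exp 1 ≤ (L + 1) * 2.7182818286 :=
    mul_le_mul hp.le he.le (Real.exp_pos 1).le (by linarith)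
  linarith

theorem ofCoeff_sum_smul {n : ℕ} {ι : Type*} (s : Finset ι) (c : ι → ℝ) (g : ι → Label n → ℝ) :
    ∑ i ∈ s, (c i : ℂ) • ofCoeff (g i) = ofCoeff fun b => ∑ i ∈ s, c i * g i b := by
  simp only [ofCoeff, Finset.smul_sum, smul_smul]
  rw [Finset.sum_comm]
  refine Finset.sum_congr rfl fun b _ => ?_
  rw [← Finset.sum_smul]
  push_cast
  rfl

/-! ### Bias, variance and concentration of the estimator. -/

section Data

variable {n m : ℕ} {ρ : QMatrix n} {Ω : Type*} [MeasurableSpace Ω] {μ : Measure Ω}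
  [IsProbabilityMeasure μ] {R : Setting n → Fin m → Ω → Outcome n}

theorem sum_law_mul_designMatrix {w : Outcome n → ℝ} {a : Setting n}
    (hw : ∀ r, (w r : ℂ) = (ρ * outcomeProj a r).trace) (b : Label n) :
    ∑ r, w r * designMatrix n (r, a) b = observes a b * (2 ^ n * pauliCoeff ρ b) := by
  have h : ((∑ r, w r * designMatrix n (r, a) b : ℝ) : ℂ) =
      (observes a b : ℂ) * (pauliString b * ρ).trace := by
    rw [Matrix.trace_mul_comm, ← smul_eq_mul, ← Matrix.trace_smul, ← Matrix.mul_smul,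
      ← sum_designMatrix_smul_outcomeProj, Finset.mul_sum, Matrix.trace_sum]
    push_cast
    refine Finset.sum_congr rfl fun r _ => ?_
    rw [hw, Matrix.mul_smul, Matrix.trace_smul, smul_eq_mul, mul_comm]
  have h' := congrArg Complex.re h
  rw [Complex.ofReal_re, Complex.re_ofReal_mul] at h'
  rw [h', pauliCoeff]
  field_simp

theorem sum_observes_prod (b : Label n) :
    ∑ p : Setting n × Fin m, observes p.1 b = 3 ^ numI b * m := by
  rw [Fintype.sum_prod_type, ← sum_observes, Finset.sum_mul]
  refine Finset.sum_congr rfl fun a _ => ?_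
  simp [mul_comm]

theorem integral_coeffEstimator (hm : 1 ≤ m) (hmeas : ∀ a i, Measurable (R a i))
    (hlaw : ∀ a i r, ((μ.real {ω | R a i ω = r} : ℝ) : ℂ) = (ρ * outcomeProj a r).trace)
    (b : Label n) :
    ∫ ω, coeffEstimator (fun a i => R a i ω) b ∂μ = pauliCoeff ρ b := by
  have hm' : (m : ℝ) ≠ 0 := by positivity
  simp only [coeffEstimator_eq]
  rw [integral_const_mul, integral_finsetSum _ fun p _ =>
    integrable_comp_of_fintype (hmeas p.1 p.2) fun r => designMatrix n (r, p.1) b]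
  have h : ∀ p : Setting n × Fin m, ∫ ω, designMatrix n (R p.1 p.2 ω, p.1) b ∂μ =
      observes p.1 b * (2 ^ n * pauliCoeff ρ b) := fun p => by
    rw [integral_comp_eq_sum (hmeas p.1 p.2) fun r => designMatrix n (r, p.1) b]
    exact sum_law_mul_designMatrix (hlaw p.1 p.2) b
  simp only [h]
  rw [← Finset.sum_mul, sum_observes_prod]
  field_simp

theorem memLp_coeffEstimator (hmeas : ∀ a i, Measurable (R a i)) (b : Label n) (q : ENNReal) :
    MemLp (fun ω => coeffEstimator (fun a i => R a i ω) b) q μ :=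
  memLp_comp_of_fintype (Q := fun ω a i => R a i ω)
    (measurable_pi_lambda _ fun a => measurable_pi_lambda _ fun i => hmeas a i)
    (fun x => coeffEstimator x b) q

theorem variance_coeffEstimator_le (hm : 1 ≤ m) (hmeas : ∀ a i, Measurable (R a i))
    (hindep : iIndepFun (fun p : Setting n × Fin m => R p.1 p.2) μ) (b : Label n) :
    variance (fun ω => coeffEstimator (fun a i => R a i ω) b) μ ≤
      1 / (3 ^ numI b * 4 ^ n * (m : ℝ)) := by
  have hm' : (m : ℝ) ≠ 0 := by positivity
  set Z : Setting n × Fin m → Ω → ℝ := fun p ω => designMatrix n (R p.1 p.2 ω, p.1) b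
  have hZ : ∀ p, MemLp (Z p) 2 μ := fun p =>
    memLp_comp_of_fintype (hmeas p.1 p.2) (fun r => designMatrix n (r, p.1) b) 2
  have hvar : ∀ p, variance (Z p) μ ≤ observes p.1 b := by
    intro p
    refine (variance_le_expectation_sq (hZ p).aestronglyMeasurable).trans_eq ?_
    simp [Z, designMatrix_sq]
  have hsum : variance (fun ω => ∑ p, Z p ω) μ = ∑ p, variance (Z p) μ := by
    rw [← IndepFun.variance_sum (fun p _ => hZ p)]
    · congr 1
      ext ω
      simp
    · intro p _ q _ hpq
      exact (hindep.indepFun hpq).comp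
        (measurable_of_countable fun r => designMatrix n (r, p.1) b)
        (measurable_of_countable fun r => designMatrix n (r, q.1) b)
  simp only [coeffEstimator_eq]
  rw [variance_const_mul, hsum]
  calc _ ≤ (1 / (3 ^ numI b * 2 ^ n * (m : ℝ))) ^ 2 * ∑ p : Setting n × Fin m, observes p.1 b :=
        mul_le_mul_of_nonneg_left (Finset.sum_le_sum fun p _ => hvar p) (sq_nonneg _)
    _ = _ := by
        rw [sum_observes_prod, show (4 : ℝ) ^ n = (2 ^ n) ^ 2 by
          rw [← pow_mul, mul_comm, pow_mul]; norm_num]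
        field_simp

/-- The mean of one shot depends on its setting and only the total recovers `ρ`: the number `3 ^
numI b` of settings observing `b` cancels the normalisation. -/
theorem sum_law_smul_singleShot (hm : 1 ≤ m) (hρ : ρ.IsHermitian)
    {w : Setting n × Fin m → Outcome n → ℝ}
    (hw : ∀ p r, (w p r : ℂ) = (ρ * outcomeProj p.1 r).trace) :
    (1 / m : ℂ) • ∑ p : Setting n × Fin m, ∑ r, (w p r : ℂ) • singleShot p.1 r = ρ := by
  have hm' : (m : ℝ) ≠ 0 := by positivity
  have h1 : ∀ p : Setting n × Fin m, ∑ r, (w p r : ℂ) • singleShot p.1 r =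
      ((1 : ℝ) : ℂ) • ofCoeff fun b => 1 / 3 ^ numI b * (observes p.1 b * pauliCoeff ρ b) := by
    intro p
    simp only [singleShot]
    rw [ofCoeff_sum_smul, Complex.ofReal_one, one_smul]
    congr 1
    funext b
    calc _ = 1 / (3 ^ numI b * 2 ^ n) * ∑ r, w p r * designMatrix n (r, p.1) b := by
          rw [Finset.mul_sum]
          exact Finset.sum_congr rfl fun r _ => by ring
      _ = _ := by
          rw [sum_law_mul_designMatrix (hw p)]
          field_simp
  simp only [h1]
  rw [ofCoeff_sum_smul]
  have h2 : (1 / m : ℂ) • ofCoeff (fun b => ∑ p : Setting n × Fin m, 1 * (1 / 3 ^ numI b *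
      (observes p.1 b * pauliCoeff ρ b))) = ofCoeff (pauliCoeff ρ) := by
    have := ofCoeff_sum_smul {()} (fun _ => (1 / m : ℝ)) fun _ (b : Label n) =>
      ∑ p : Setting n × Fin m, 1 * (1 / 3 ^ numI b * (observes p.1 b * pauliCoeff ρ b))
    simp only [Finset.sum_singleton] at this
    push_cast at this
    rw [this]
    congr 1
    funext b
    simp only [one_mul]
    rw [← Finset.mul_sum, ← Finset.sum_mul, sum_observes_prod]
    field_simp
  rw [h2]
  exact (ofCoeff_eq_iff hρ _).2 rfl

theorem integral_opNorm_pow_le (hm : 1 ≤ m) (hρ : ρ.IsHermitian)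
    (hmeas : ∀ a i, Measurable (R a i))
    (hindep : iIndepFun (fun p : Setting n × Fin m => R p.1 p.2) μ)
    (hlaw : ∀ a i r, ((μ.real {ω | R a i ω = r} : ℝ) : ℂ) = (ρ * outcomeProj a r).trace) (p : ℕ) :
    ∫ ω, opNorm (linearEstimator (fun a i => R a i ω) - ρ) ^ (2 * p) ∂μ ≤
      2 ^ n * (4 * ((4 / 3) ^ n / m) * p) ^ p := by
  have hm' : (m : ℝ) ≠ 0 := by positivity
  set w : Setting n × Fin m → Outcome n → ℝ := fun k r => μ.real {ω | R k.1 k.2 ω = r} with hw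
  have hw1 : ∀ k, ∑ r, w k r = 1 := fun k => sum_measureReal_eq_one (hmeas k.1 k.2)
  set mean : Setting n × Fin m → QMatrix n := fun k => ∑ r, (w k r : ℂ) • singleShot k.1 r
    with hmean
  set Y : Setting n × Fin m → Outcome n → QMatrix n :=
    fun k r => (1 / m : ℂ) • (singleShot k.1 r - mean k) with hY
  have hreal : ∀ (c : ℝ) {A : QMatrix n}, A.IsHermitian → ((c : ℂ) • A).IsHermitian := by
    intro c A hA
    rw [Matrix.IsHermitian, Matrix.conjTranspose_smul, hA.eq, Complex.star_def,
      Complex.conj_ofReal]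
  have hmeanH : ∀ k, (mean k).IsHermitian := fun k => by
    simp only [hmean, Matrix.IsHermitian, Matrix.conjTranspose_sum]
    exact Finset.sum_congr rfl fun r _ => (hreal _ (singleShot_isHermitian _ _)).eq
  have hYH : ∀ k r, (Y k r).IsHermitian := fun k r => by
    have := hreal (1 / m) ((singleShot_isHermitian k.1 r).sub (hmeanH k))
    push_cast at this
    exact this
  have hY0 : ∀ k, ∑ r, (w k r : ℂ) • Y k r = 0 := by
    intro k
    have h1 : ∑ r, (w k r : ℂ) = 1 := by exact_mod_cast congrArg Complex.ofReal (hw1 k)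
    simp only [hY, smul_comm _ (1 / m : ℂ)]
    rw [← Finset.smul_sum]
    simp only [smul_sub, Finset.sum_sub_distrib]
    rw [← Finset.sum_smul, h1, one_smul, hmean]
    simp
  -- The means cancel in `Y k r - Y k r'`, leaving the single-shot bound scaled by `1 / m^2`.
  -- Multiplied by the `3^n m` summands, this constant gives `4 (4/3)^n / m`.
  have hc : ∀ k r r', (((4 * (4 / 9) ^ n / m ^ 2 : ℝ) : ℂ) • (1 : QMatrix n) -
      (Y k r - Y k r') ^ 2).PosSemidef := by
    intro k r r'
    have h := (singleShot_sub_sq_le k.1 r r').smul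
      (Complex.zero_le_real.2 (by positivity : (0 : ℝ) ≤ 1 / m ^ 2))
    convert h using 1
    simp only [hY, ← smul_sub, sub_sub_sub_cancel_right, smul_pow]
    rw [smul_sub, smul_smul]
    push_cast
    congr 2 <;> ring
  have hS : ∀ x : Setting n × Fin m → Outcome n, ∑ k, Y k (x k) =
      linearEstimator (fun a i => x (a, i)) - ρ := by
    intro x
    rw [linearEstimator_eq]
    nth_rewrite 1 [← sum_law_smul_singleShot hm hρ (w := w) fun k r => hlaw k.1 k.2 r]
    rw [← smul_sub, ← Finset.sum_sub_distrib, Finset.smul_sum]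
  have hQ : Measurable fun ω (k : Setting n × Fin m) => R k.1 k.2 ω :=
    measurable_pi_lambda _ fun k => hmeas k.1 k.2
  have hint := integral_comp_eq_sum (μ := μ) hQ
    fun x => opNorm (linearEstimator (fun a i => x (a, i)) - ρ) ^ (2 * p)
  rw [hint]
  calc _ ≤ ∑ x : Setting n × Fin m → Outcome n, (∏ k, w k (x k)) *
        ((∑ k, Y k (x k)) ^ (2 * p)).trace.re := by
        refine Finset.sum_le_sum fun x _ => ?_
        rw [measureReal_joint_eq_prod hindep, hS]
        exact mul_le_mul_of_nonneg_left
          (opNorm_pow_le_trace ((ofCoeff_isHermitian _).sub hρ) p)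
          (Finset.prod_nonneg fun k _ => measureReal_nonneg)
    _ ≤ _ := moment_le (fun k r => measureReal_nonneg) hw1 hYH hY0 (by positivity) hc p
    _ = _ := by
        have hA : Fintype.card Axis = 3 := rfl
        have : (4 / 3 : ℝ) ^ n = 3 ^ n * (4 / 9) ^ n := by
          rw [← mul_pow]
          norm_num
        simp only [Fintype.card_prod, Fintype.card_pi, Fintype.card_fin, hA, Finset.prod_const,
          Finset.card_univ, this]
        push_cast
        congr 2
        field_simp

theorem measureReal_opNorm_le (hm : 1 ≤ m) (hn : n ≠ 0) (hρ : ρ.IsHermitian)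
    (hmeas : ∀ a i, Measurable (R a i))
    (hindep : iIndepFun (fun p : Setting n × Fin m => R p.1 p.2) μ)
    (hlaw : ∀ a i r, ((μ.real {ω | R a i ω = r} : ℝ) : ℂ) = (ρ * outcomeProj a r).trace)
    {ε : ℝ} (hε : 0 < ε) (hε1 : ε < 1) :
    μ.real {ω | 4 * Real.sqrt (2 * (4 / 3 : ℝ) ^ n * ((n * Real.log 2 - Real.log ε) / m)) ≤
      opNorm (linearEstimator (fun a i => R a i ω) - ρ)} ≤ ε := by
  have hm' : (0 : ℝ) < m := by positivity
  set L := n * Real.log 2 - Real.log ε with hLdef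
  have hlog2 : 0 < Real.log 2 := Real.log_pos one_lt_two
  -- This is where `n ≠ 0` and `ε < 1` enter.
  have hL : Real.log 2 ≤ L := by
    have h1 : (1 : ℝ) ≤ n := by exact_mod_cast Nat.one_le_iff_ne_zero.2 hn
    have h2 := Real.log_neg hε hε1
    nlinarith
  have hL0 : 0 < L := hlog2.trans_le hL
  set s : ℝ := (4 / 3) ^ n / m with hs
  have hs0 : 0 < s := by positivity
  set t := 4 * Real.sqrt (2 * (4 / 3 : ℝ) ^ n * (L / m)) with ht
  set p := ⌈L⌉₊ with hp
  have ht0 : 0 ≤ t := by positivity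
  have ht2 : t ^ (2 * p) = (32 * s * L) ^ p := by
    rw [pow_mul, ht, mul_pow, Real.sq_sqrt (by positivity), hs]
    congr 1
    ring
  have hpos : 0 < (32 * s * L) ^ p := by positivity
  set N : Ω → ℝ := fun ω => opNorm (linearEstimator (fun a i => R a i ω) - ρ)
  have hQ : Measurable fun ω (a : Setting n) (i : Fin m) => R a i ω :=
    measurable_pi_lambda _ fun a => measurable_pi_lambda _ fun i => hmeas a i
  have hN0 : ∀ ω, 0 ≤ N ω := fun ω => norm_nonneg _
  have hmarkov := mul_meas_ge_le_integral_of_nonneg (μ := μ) (f := fun ω => N ω ^ (2 * p))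
    (ae_of_all _ fun ω => pow_nonneg (hN0 ω) _)
    (integrable_comp_of_fintype hQ fun x => opNorm (linearEstimator x - ρ) ^ (2 * p))
    (t ^ (2 * p))
  have hsub : μ.real {ω | t ≤ N ω} ≤ μ.real {ω | t ^ (2 * p) ≤ N ω ^ (2 * p)} :=
    measureReal_mono fun ω hω => pow_le_pow_left₀ ht0 hω _
  -- Rounding `L` up to an integer only helps here, as `p ≥ L`.
  have hexp : Real.exp (-1) ^ p ≤ Real.exp (-L) := by
    rw [← Real.exp_nat_mul]
    refine Real.exp_le_exp.2 ?_
    have := Nat.le_ceil L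
    linarith
  have hεL : 2 ^ n * Real.exp (-L) = ε := by
    rw [hLdef, neg_sub, Real.exp_sub, Real.exp_log hε, Real.exp_nat_mul, Real.exp_log two_pos]
    field_simp
  refine le_of_mul_le_mul_left ?_ hpos
  calc (32 * s * L) ^ p * μ.real {ω | t ≤ N ω}
      ≤ t ^ (2 * p) * μ.real {ω | t ^ (2 * p) ≤ N ω ^ (2 * p)} := by
        rw [ht2]
        rw [ht2] at hsub
        exact mul_le_mul_of_nonneg_left hsub hpos.le
    _ ≤ 2 ^ n * (4 * s * p) ^ p :=
        hmarkov.trans (integral_opNorm_pow_le hm hρ hmeas hindep hlaw p)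
    _ ≤ 2 ^ n * (32 * s * L * Real.exp (-1)) ^ p := by
        have : 4 * s * p ≤ 32 * s * L * Real.exp (-1) := by
          calc 4 * s * p ≤ 4 * s * (8 * L * Real.exp (-1)) :=
                mul_le_mul_of_nonneg_left (le_exp_neg_one_mul hL) (by positivity)
            _ = _ := by ring
        gcongr
    _ = (32 * s * L) ^ p * (2 ^ n * Real.exp (-1) ^ p) := by
        rw [mul_pow (32 * s * L)]
        ring
    _ ≤ (32 * s * L) ^ p * (2 ^ n * Real.exp (-L)) := by gcongr
    _ = (32 * s * L) ^ p * ε := by rw [hεL]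

end Data

/-- Without qubits the only density matrix is 1 and the estimator is deterministic. This case is
separate because `L` may then be below `log 2`. -/
theorem linearEstimator_eq_of_zero {m : ℕ} (hm : 1 ≤ m) {ρ : QMatrix 0} (hρ : ρ.trace = 1)
    (R : Setting 0 → Fin m → Outcome 0) : linearEstimator R = ρ := by
  have hm' : (m : ℂ) ≠ 0 := by exact_mod_cast (by omega : m ≠ 0)
  have h1 : ∀ a r, singleShot (n := 0) a r = 1 := fun a r => by
    rw [singleShot_eq_tensor, ← tensor_one]
    congr 1
    exact Subsingleton.elim _ _
  have hρ1 : ρ = 1 := by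
    ext i j
    rw [Matrix.trace, Fintype.sum_unique] at hρ
    rw [Subsingleton.elim j i, Matrix.one_apply_eq, ← hρ, Matrix.diag_apply]
    exact congrArg₂ ρ (Subsingleton.elim _ _) (Subsingleton.elim _ _)
  rw [linearEstimator_eq, hρ1]
  simp only [h1, Finset.sum_const, Finset.card_univ, Fintype.card_prod, Fintype.card_fin]
  rw [Fintype.card_unique, one_mul, ← Nat.cast_smul_eq_nsmul ℂ, smul_smul, one_div,
    inv_mul_cancel₀ hm', one_smul]

end QubitTomography

theorem proposition2 {n m : ℕ} (hm : 1 ≤ m)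
    (ρ : QubitTomography.QMatrix n) (hρ : QubitTomography.IsDensityMatrix ρ)
    {Ω : Type*} [MeasurableSpace Ω] (μ : Measure Ω) [IsProbabilityMeasure μ]
    (R : QubitTomography.Setting n → Fin m → Ω → QubitTomography.Outcome n)
    (hmeas : ∀ a i, Measurable (R a i))
    (hindep : iIndepFun (fun p : QubitTomography.Setting n × Fin m => R p.1 p.2) μ)
    (hlaw : ∀ a i r, ((μ.real {ω | R a i ω = r} : ℝ) : ℂ) =
      (ρ * QubitTomography.outcomeProj a r).trace) :
    (∀ b : QubitTomography.Label n,
      Integrable (fun ω => QubitTomography.coeffEstimator (fun a i => R a i ω) b) μ ∧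
      ∫ ω, QubitTomography.coeffEstimator (fun a i => R a i ω) b ∂μ =
        QubitTomography.pauliCoeff ρ b) ∧
    (∀ b : QubitTomography.Label n,
      MemLp (fun ω => QubitTomography.coeffEstimator (fun a i => R a i ω) b) 2 μ ∧
      variance (fun ω => QubitTomography.coeffEstimator (fun a i => R a i ω) b) μ ≤
        1 / (3 ^ QubitTomography.numI b * 4 ^ n * (m : ℝ))) ∧
    (∀ ε : ℝ, 0 < ε →
      μ.real {ω | 4 * Real.sqrt (2 * (4 / 3 : ℝ) ^ n * ((n * Real.log 2 - Real.log ε) / m)) ≤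
        QubitTomography.opNorm
          (QubitTomography.linearEstimator (fun a i => R a i ω) - ρ)} ≤ ε) := by
  refine ⟨fun b => ⟨?_, ?_⟩, fun b => ⟨?_, ?_⟩, fun ε hε => ?_⟩
  · exact memLp_one_iff_integrable.1 (QubitTomography.memLp_coeffEstimator hmeas b 1)
  · exact QubitTomography.integral_coeffEstimator hm hmeas hlaw b
  · exact QubitTomography.memLp_coeffEstimator hmeas b 2
  · exact QubitTomography.variance_coeffEstimator_le hm hmeas hindep b
  · rcases le_or_gt 1 ε with h1 | h1
    · exact measureReal_le_one.trans h1
    rcases eq_or_ne n 0 with rfl | hn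
    -- The event uses a non-strict inequality, so zero error excludes it only because the threshold
    -- is strictly positive, which follows from `ε < 1`.
    · have hpos : 0 < 4 * Real.sqrt (2 * (4 / 3 : ℝ) ^ 0 *
          (((0 : ℕ) * Real.log 2 - Real.log ε) / m)) := by
        have hlog := neg_pos.2 (Real.log_neg hε h1)
        have hm0 : (0 : ℝ) < m := by positivity
        have := div_pos hlog hm0
        refine mul_pos four_pos (Real.sqrt_pos.2 ?_)
        rw [Nat.cast_zero, zero_mul, zero_sub]
        positivity
      have hnorm : ∀ ω, QubitTomography.opNorm
          (QubitTomography.linearEstimator (fun a i => R a i ω) - ρ) = 0 := fun ω => by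
        rw [QubitTomography.linearEstimator_eq_of_zero hm hρ.2, sub_self,
          QubitTomography.opNorm, map_zero, norm_zero]
      simp only [hnorm, not_le.2 hpos, Set.ofPred_false, measureReal_empty]
      exact hε.le
    · exact QubitTomography.measureReal_opNorm_le hm hn hρ.1.1 hmeas hindep hlaw hε h1
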